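/- Let $m, n, k \ge 1$ and $q, t \ge 0$ be integers. An $m \times n$ complex matrix $A$ is called a $(q,k,t)$-design matrix if every row of $A$ has at most $q$ nonzero entries, every column of $A$ has at least $k$ nonzero entries, and for any two distinct columns there are at most $t$ rows in which both columns have a nonzero entry. Every $m \times n$ complex $(q,k,t)$-design matrix $A$ satisfies $$\operatorname{rank}(A) \;\ge\; \frac{n}{1 + \frac{q(q-1)mt}{nk^2}} \;\ge\; n - \frac{mtq(q-1)}{k^2}.$$ -/

import Mathlib

/-- An `m × n` matrix `A` over a field is a `(q, k, t)`-design matrix if every row has at most `q`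
nonzero entries, every column has at least `k` nonzero entries, and the supports of any two
distinct columns meet in at most `t` positions. -/
structure IsDesignMatrix {F : Type*} [Field F] {m n : ℕ} (A : Matrix (Fin m) (Fin n) F)
    (q k t : ℕ) : Prop where
  row_support : ∀ i : Fin m, (Function.support (A.row i)).ncard ≤ q
  col_support : ∀ j : Fin n, k ≤ (Function.support (A.col j)).ncard
  col_inter : ∀ j₁ j₂ : Fin n, j₁ ≠ j₂ →
    (Function.support (A.col j₁) ∩ Function.support (A.col j₂)).ncard ≤ t

open Finset Filter Topology

/-! Multiplying by diagonal matrices on both sides does not raise the rank and keeps zeros, so `A`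
may be replaced by a scaled `B` whose squared moduli have row sums at most `q`, total `nk`, and
column sums at most `k + δ` (`exists_approx_scaling`). The Gram matrix `M = BᴴB` then has trace
`nk`. Off the diagonal at most `t` rows contribute to an entry, so Cauchy–Schwarz gives `|M i j|² ≤
t ∑ r, |B r i|² |B r j|²`; each row contributes at most `q(q-1)` to the sum over `i ≠ j`
(`mul_sum_offDiag_le`). Comparing trace with Frobenius norm bounds the rank below, and `δ → 0`
finishes. -/

/-- Approximate matrix scaling: a nonnegative matrix `a` whose support contains that of `p` can be
rescaled so that its row sums are those of `p` and its column sums are arbitrarily close to those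
of `p`. -/
theorem exists_approx_scaling {ι κ : Type*} [Fintype ι] [Fintype κ] [DecidableEq κ]
    (a p : ι → κ → ℝ) (ha : ∀ r j, 0 ≤ a r j) (hp : ∀ r j, 0 ≤ p r j)
    (hap : ∀ r j, p r j ≠ 0 → 0 < a r j) {δ : ℝ} (hδ : 0 < δ) :
    ∃ x : κ → ℝ, ∀ j, |∑ r, (∑ i, p r i) * (Real.exp (x j) * a r j /
      ∑ i, Real.exp (x i) * a r i) - ∑ r, p r j| ≤ δ := by
  set R : ι → (κ → ℝ) → ℝ := fun r x => ∑ i, Real.exp (x i) * a r i with hR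
  set w : ι → ℝ := fun r => ∑ i, p r i with hw
  set s : κ → ℝ := fun j => ∑ r, p r j with hs
  have hwR : ∀ r, w r = 0 ∨ ∀ x, 0 < R r x := by
    intro r
    by_cases h : ∃ j, p r j ≠ 0
    · obtain ⟨j, hj⟩ := h
      refine Or.inr fun x => ?_
      exact sum_pos' (fun i _ => mul_nonneg (Real.exp_pos _).le (ha r i))
        ⟨j, mem_univ _, mul_pos (Real.exp_pos _) (hap r j hj)⟩
    · push Not at h
      exact Or.inl (sum_eq_zero fun i _ => h i)
  -- The partial derivatives of this potential are the column-sum errors. Its infimum need not be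
  -- attained, hence the quadratic penalty in `g`.
  set f : (κ → ℝ) → ℝ := fun x => ∑ r, w r * Real.log (R r x) - ∑ j, s j * x j with hf
  set C : ℝ := ∑ r, ∑ j, p r j * Real.log (a r j) with hC
  have hRc : ∀ r, Continuous (R r) := fun r => by fun_prop
  have hfc : Continuous f := by
    refine Continuous.sub (continuous_finsetSum _ fun r _ => ?_) (by fun_prop)
    rcases hwR r with h | h
    · simp only [h, zero_mul]; exact continuous_const
    · exact continuous_const.mul ((hRc r).log fun x => (h x).ne')
  have hfC : ∀ x, C ≤ f x := by
    intro x
    have h1 : ∑ r, ∑ j, p r j * (x j + Real.log (a r j)) ≤ ∑ r, w r * Real.log (R r x) := by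
      refine sum_le_sum fun r _ => ?_
      rw [hw, sum_mul]
      refine sum_le_sum fun j _ => ?_
      by_cases h : p r j = 0
      · simp [h]
      refine mul_le_mul_of_nonneg_left ?_ (hp r j)
      rw [← Real.log_exp (x j), ← Real.log_mul (Real.exp_pos _).ne' (hap r j h).ne']
      refine Real.log_le_log (mul_pos (Real.exp_pos _) (hap r j h)) ?_
      exact single_le_sum (f := fun i => Real.exp (x i) * a r i)
        (fun i _ => mul_nonneg (Real.exp_pos _).le (ha r i)) (mem_univ j)
    have h2 : ∑ r, ∑ j, p r j * (x j + Real.log (a r j)) = ∑ j, s j * x j + C := by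
      simp only [mul_add, sum_add_distrib, hs, hC, sum_mul]
      rw [sum_comm]
    simp only [hf]
    linarith
  -- At a minimiser of `g` the error is `-2εx_j`, and `εx_j² ≤ f 0 - C`, so its square is at most
  -- `4ε(f 0 - C) ≤ δ²`. The `+ 1` keeps the denominator positive.
  set ε : ℝ := δ ^ 2 / (4 * (f 0 - C + 1)) with hε
  have hfC0 := hfC 0
  have hε0 : 0 < ε := by positivity
  set g : (κ → ℝ) → ℝ := fun x => f x + ε * ∑ j, x j ^ 2 with hg
  have hgc : Continuous g := by fun_prop
  have hgle : ∀ x, g x ≤ g 0 → ∀ j, ε * x j ^ 2 ≤ f 0 - C := by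
    intro x hx j
    have h1 : x j ^ 2 ≤ ∑ j, x j ^ 2 :=
      single_le_sum (f := fun j => x j ^ 2) (fun i _ => sq_nonneg _) (mem_univ j)
    have h2 := hfC x
    have h3 := mul_le_mul_of_nonneg_left h1 hε0.le
    simp only [hg, Pi.zero_apply, ne_eq, OfNat.ofNat_ne_zero, not_false_eq_true, zero_pow,
      sum_const_zero, mul_zero, add_zero] at hx
    linarith
  obtain ⟨x, hx⟩ : ∃ x, ∀ y, g x ≤ g y := by
    obtain ⟨x, -, hx⟩ := (isCompact_closedBall (0 : κ → ℝ)
      (Real.sqrt ((f 0 - C) / ε))).exists_isMinOn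
      ⟨0, Metric.mem_closedBall_self (Real.sqrt_nonneg _)⟩ hgc.continuousOn
    refine ⟨x, fun y => ?_⟩
    have h0 := hx (Metric.mem_closedBall_self (Real.sqrt_nonneg _))
    rcases le_total (g y) (g 0) with h | h
    · refine hx ?_
      rw [mem_closedBall_zero_iff, pi_norm_le_iff_of_nonneg (Real.sqrt_nonneg _)]
      intro j
      refine Real.abs_le_sqrt ?_
      rw [le_div_iff₀ hε0, mul_comm]
      exact hgle y h j
    · exact le_trans h0 h
  refine ⟨x, fun j => ?_⟩
  have hu : ∀ i, HasDerivAt (fun u : ℝ => Function.update x j u i) (if i = j then 1 else 0)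
      (x j) := by
    intro i
    by_cases h : i = j
    · subst h; simpa using hasDerivAt_id' (x i)
    · simpa [h] using hasDerivAt_const (x j) (x i)
  have hux : Function.update x j (x j) = x := Function.update_eq_self j x
  have hRd : ∀ r, HasDerivAt (fun u : ℝ => R r (Function.update x j u))
      (Real.exp (x j) * a r j) (x j) := by
    intro r
    have := HasDerivAt.fun_sum (u := univ) fun i _ => ((hu i).exp.mul_const (a r i))
    simpa using this
  have hgd : HasDerivAt (fun u : ℝ => g (Function.update x j u))
      (∑ r, w r * (Real.exp (x j) * a r j / R r x) - s j + ε * (2 * x j)) (x j) := by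
    refine HasDerivAt.add (HasDerivAt.sub (HasDerivAt.fun_sum fun r _ => ?_) ?_) ?_
    · rcases hwR r with h | h
      · simpa only [h, zero_mul] using hasDerivAt_const (x j) (0 : ℝ)
      · have := ((hRd r).log (by rw [hux]; exact (h x).ne')).const_mul (w r)
        rwa [hux] at this
    · have := HasDerivAt.fun_sum (u := univ) fun i _ => ((hu i).const_mul (s i))
      simpa using this
    · have := (HasDerivAt.fun_sum (u := univ) fun i _ => ((hu i).pow 2)).const_mul ε
      simpa using this
  have hmin : IsLocalMin (fun u : ℝ => g (Function.update x j u)) (x j) :=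
    Eventually.of_forall fun u => by simpa only [hux] using hx _
  have hz := hmin.hasDerivAt_eq_zero hgd
  have hb := hgle x (hx 0) j
  refine abs_le_of_sq_le_sq ?_ hδ.le
  have he : ∑ r, w r * (Real.exp (x j) * a r j / R r x) - s j = -(2 * (ε * x j)) := by linarith
  change (∑ r, w r * (Real.exp (x j) * a r j / R r x) - s j) ^ 2 ≤ δ ^ 2
  rw [he]
  have h4 : ε * (4 * (f 0 - C + 1)) = δ ^ 2 := div_mul_cancel₀ _ (by positivity)
  have h5 := mul_le_mul_of_nonneg_left hb hε0.le
  nlinarith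

/-- The rank of a Hermitian matrix is at least the square of its trace divided by the square of
its Frobenius norm. -/
theorem Matrix.IsHermitian.sq_trace_le_rank_mul {κ : Type*} [Fintype κ] [DecidableEq κ]
    {M : Matrix κ κ ℂ} (hM : M.IsHermitian) :
    ‖M.trace‖ ^ 2 ≤ M.rank * ∑ i, ∑ j, ‖M i j‖ ^ 2 := by
  have htr : M.trace = ((∑ i, hM.eigenvalues i : ℝ) : ℂ) := by
    rw [hM.trace_eq_sum_eigenvalues]; push_cast; rfl
  have hfrob : (((∑ i, ∑ j, ‖M i j‖ ^ 2 : ℝ)) : ℂ) = (M * M).trace := by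
    simp only [Matrix.trace, Matrix.diag_apply, Matrix.mul_apply]
    push_cast
    refine sum_congr rfl fun i _ => sum_congr rfl fun j _ => ?_
    rw [← hM.apply j i, ← Complex.mul_conj']
    rfl
  have hsq : (M * M).trace = ((∑ i, hM.eigenvalues i ^ 2 : ℝ) : ℂ) := by
    conv_lhs => rw [hM.spectral_theorem]
    rw [← map_mul, Unitary.conjStarAlgAut_apply, Matrix.trace_mul_comm, ← mul_assoc,
      Unitary.coe_star_mul_self, one_mul, Matrix.diagonal_mul_diagonal, Matrix.trace_diagonal]
    push_cast
    exact sum_congr rfl fun i _ => by simp [sq]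
  rw [hsq, Complex.ofReal_inj] at hfrob
  rw [htr, Complex.norm_real, Real.norm_eq_abs, sq_abs, hfrob, hM.rank_eq_card_non_zero_eigs,
    Fintype.card_subtype]
  -- Cauchy–Schwarz over the nonzero eigenvalues only, whose number is the rank.
  rw [← sum_filter_ne_zero, ← sum_filter_of_ne (p := fun i => hM.eigenvalues i ≠ 0)
    (f := fun i => hM.eigenvalues i ^ 2) (fun i _ h => by simpa using h)]
  exact sq_sum_le_card_mul_sum_sq

/-- Sum of the products of distinct entries of a vector with few nonzero entries. -/
theorem mul_sum_offDiag_le {κ : Type*} [Fintype κ] [DecidableEq κ] (z : κ → ℝ) (q : ℕ)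
    (hz : (Function.support z).ncard ≤ q) :
    (q : ℝ) * ∑ i, ∑ j, (if i = j then 0 else z i * z j) ≤ (q - 1) * (∑ i, z i) ^ 2 := by
  have h1 : ∑ i, ∑ j, (if i = j then 0 else z i * z j) = (∑ i, z i) ^ 2 - ∑ i, z i ^ 2 := by
    rw [eq_sub_iff_add_eq, ← sum_add_distrib, sq, sum_mul_sum]
    refine sum_congr rfl fun i _ => ?_
    have : ∀ j, z i * z j = (if i = j then 0 else z i * z j) + if i = j then z i ^ 2 else 0 := by
      intro j; by_cases h : i = j
      · subst h; simp [sq]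
      · simp [h]
    rw [sum_congr rfl fun j _ => this j, sum_add_distrib]
    simp
  have h2 : (∑ i, z i) ^ 2 ≤ q * ∑ i, z i ^ 2 := by
    have hc : #{i | z i ≠ 0} ≤ q := by
      rw [← Set.ncard_coe_finset]; convert hz using 2; ext; simp
    calc (∑ i, z i) ^ 2 = (∑ i with z i ≠ 0, z i) ^ 2 := by rw [sum_filter_ne_zero]
      _ ≤ #{i | z i ≠ 0} * ∑ i with z i ≠ 0, z i ^ 2 := sq_sum_le_card_mul_sum_sq
      _ ≤ q * ∑ i, z i ^ 2 := by
        refine mul_le_mul (by exact_mod_cast hc)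
          (sum_le_sum_of_subset_of_nonneg (filter_subset _ _) fun _ _ _ => sq_nonneg _)
          (sum_nonneg fun _ _ => sq_nonneg _) (Nat.cast_nonneg _)
  rw [h1]
  linarith

/-- Frobenius norm bound for the Gram matrix of a scaled design matrix. -/
theorem IsDesignMatrix.sum_sq_norm_gram_le {m n q k t : ℕ} {A : Matrix (Fin m) (Fin n) ℂ}
    (hA : IsDesignMatrix A q k t) (hq : 1 ≤ q) (B : Matrix (Fin m) (Fin n) ℂ)
    (hB : ∀ r j, A r j = 0 → B r j = 0) (hrow : ∀ r, ∑ j, ‖B r j‖ ^ 2 ≤ q) :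
    ∑ i, ∑ j, ‖(B.conjTranspose * B) i j‖ ^ 2 ≤
      ∑ j, (∑ r, ‖B r j‖ ^ 2) ^ 2 + m * t * q * (q - 1) := by
  have hq' : (1 : ℝ) ≤ q := by exact_mod_cast hq
  have hent : ∀ i j, ‖(B.conjTranspose * B) i j‖ ≤ ∑ r, ‖B r i‖ * ‖B r j‖ := by
    intro i j
    rw [Matrix.mul_apply]
    refine (norm_sum_le _ _).trans (sum_le_sum fun r _ => ?_)
    simp
  have hoff : ∀ i j, i ≠ j → ‖(B.conjTranspose * B) i j‖ ^ 2 ≤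
      t * ∑ r, ‖B r i‖ ^ 2 * ‖B r j‖ ^ 2 := by
    intro i j hij
    have hc : #{r | ‖B r i‖ * ‖B r j‖ ≠ 0} ≤ t := by
      rw [← Set.ncard_coe_finset]
      refine (Set.ncard_le_ncard (fun r hr => ?_) (Set.toFinite _)).trans (hA.col_inter i j hij)
      simp only [coe_filter, mem_univ, true_and, Set.mem_ofPred_eq, ne_eq, mul_eq_zero,
        norm_eq_zero, not_or] at hr
      exact ⟨fun h => hr.1 (hB r i h), fun h => hr.2 (hB r j h)⟩
    calc ‖(B.conjTranspose * B) i j‖ ^ 2 ≤ (∑ r, ‖B r i‖ * ‖B r j‖) ^ 2 := by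
          gcongr; exact hent i j
      _ = (∑ r with ‖B r i‖ * ‖B r j‖ ≠ 0, ‖B r i‖ * ‖B r j‖) ^ 2 := by rw [sum_filter_ne_zero]
      _ ≤ #{r | ‖B r i‖ * ‖B r j‖ ≠ 0} *
          ∑ r with ‖B r i‖ * ‖B r j‖ ≠ 0, (‖B r i‖ * ‖B r j‖) ^ 2 := sq_sum_le_card_mul_sum_sq
      _ ≤ t * ∑ r, (‖B r i‖ * ‖B r j‖) ^ 2 := by
        refine mul_le_mul (by exact_mod_cast hc)
          (sum_le_sum_of_subset_of_nonneg (filter_subset _ _) fun _ _ _ => sq_nonneg _)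
          (sum_nonneg fun _ _ => sq_nonneg _) (Nat.cast_nonneg _)
      _ = t * ∑ r, ‖B r i‖ ^ 2 * ‖B r j‖ ^ 2 := by simp only [mul_pow]
  have hrow2 : ∀ r, ∑ i, ∑ j, (if i = j then 0 else ‖B r i‖ ^ 2 * ‖B r j‖ ^ 2) ≤
      (q : ℝ) * (q - 1) := by
    intro r
    have h1 := mul_sum_offDiag_le (fun j => ‖B r j‖ ^ 2) q (by
      refine (Set.ncard_le_ncard (fun j hj => ?_) (Set.toFinite _)).trans (hA.row_support r)
      exact fun h => hj (by simp [hB r j h]))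
    have h2 : (∑ j, ‖B r j‖ ^ 2) ^ 2 ≤ (q : ℝ) ^ 2 := by
      gcongr; exact hrow r
    have h3 := mul_le_mul_of_nonneg_left h2 (sub_nonneg.2 hq')
    refine le_of_mul_le_mul_left (a := (q : ℝ)) ?_ (by linarith)
    exact (h1.trans h3).trans (by apply le_of_eq; ring)
  have hpt : ∀ i j, ‖(B.conjTranspose * B) i j‖ ^ 2 ≤
      (if i = j then (∑ r, ‖B r i‖ ^ 2) ^ 2 else 0) +
        t * ∑ r, (if i = j then 0 else ‖B r i‖ ^ 2 * ‖B r j‖ ^ 2) := by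
    intro i j
    by_cases h : i = j
    · subst h
      have := hent i i
      simp only [← sq] at this
      simp only [if_true, sum_const_zero, mul_zero, add_zero]
      gcongr
    · simpa [h] using hoff i j h
  calc ∑ i, ∑ j, ‖(B.conjTranspose * B) i j‖ ^ 2
      ≤ ∑ i, ∑ j, ((if i = j then (∑ r, ‖B r i‖ ^ 2) ^ 2 else 0) +
        t * ∑ r, (if i = j then 0 else ‖B r i‖ ^ 2 * ‖B r j‖ ^ 2)) :=
        sum_le_sum fun i _ => sum_le_sum fun j _ => hpt i j
    _ = ∑ j, (∑ r, ‖B r j‖ ^ 2) ^ 2 +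
        t * ∑ r, ∑ i, ∑ j, (if i = j then 0 else ‖B r i‖ ^ 2 * ‖B r j‖ ^ 2) := by
        simp only [sum_add_distrib, sum_ite_eq, mem_univ, if_true, ← mul_sum]
        congr 2
        refine (sum_congr rfl fun i _ => ?_).trans sum_comm
        exact sum_comm
    _ ≤ ∑ j, (∑ r, ‖B r j‖ ^ 2) ^ 2 + t * ∑ r : Fin m, (q : ℝ) * (q - 1) := by
        gcongr with r
        exact hrow2 r
    _ = ∑ j, (∑ r, ‖B r j‖ ^ 2) ^ 2 + m * t * q * (q - 1) := by
        simp; ring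

/-- The rank bound for design matrices, up to an arbitrarily small error. -/
theorem IsDesignMatrix.sq_le_rank_mul_add {m n q k t : ℕ} {A : Matrix (Fin m) (Fin n) ℂ}
    (hA : IsDesignMatrix A q k t) (hq : 1 ≤ q) (hk : 1 ≤ k) {δ : ℝ} (hδ : 0 < δ) :
    ((n : ℝ) * k) ^ 2 ≤ A.rank * (n * (k + δ) ^ 2 + m * t * q * (q - 1)) := by
  set d : Fin n → ℕ := fun j => (Function.support (A.col j)).ncard with hd
  have hkd : ∀ j, (k : ℝ) ≤ d j := fun j => by exact_mod_cast hA.col_support j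
  have hk' : (1 : ℝ) ≤ k := by exact_mod_cast hk
  have hd0 : ∀ j, (0 : ℝ) < d j := fun j => by linarith [hkd j]
  -- Equal weights on each column's support: column sums are exactly `k`, and entries are at most 1,
  -- so row sums are at most `q`.
  set p : Fin m → Fin n → ℝ := fun r j => if A r j = 0 then 0 else k / d j with hp
  have hp0 : ∀ r j, 0 ≤ p r j := by
    intro r j; simp only [hp]; split_ifs
    · exact le_rfl
    · exact div_nonneg (by linarith) (hd0 j).le
  have hpcol : ∀ j, ∑ r, p r j = k := by
    intro j
    have hc : #{r | ¬ A r j = 0} = d j := by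
      rw [← Set.ncard_coe_finset, hd]; congr 1; ext; simp
    simp only [hp]
    rw [sum_ite, sum_const_zero, zero_add, sum_const, hc, nsmul_eq_mul,
      mul_div_cancel₀ _ (hd0 j).ne']
  set w : Fin m → ℝ := fun r => ∑ i, p r i with hw
  have hw0 : ∀ r, 0 ≤ w r := fun r => sum_nonneg fun i _ => hp0 r i
  have hwq : ∀ r, w r ≤ q := by
    intro r
    have hc : #{j | ¬ A r j = 0} ≤ q := by
      rw [← Set.ncard_coe_finset]; convert hA.row_support r using 2; ext; simp
    simp only [hw, hp]
    rw [sum_ite, sum_const_zero, zero_add]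
    calc ∑ j with ¬ A r j = 0, (k : ℝ) / d j ≤ ∑ j with ¬ A r j = 0, (1 : ℝ) :=
          sum_le_sum fun j _ => (div_le_one (hd0 j)).2 (hkd j)
      _ ≤ q := by simpa using hc
  obtain ⟨x, hx⟩ := exists_approx_scaling (fun r j => ‖A r j‖ ^ 2) p (fun _ _ => sq_nonneg _) hp0
    (fun r j h => by
      have : A r j ≠ 0 := fun h' => h (by simp [hp, h'])
      positivity) hδ
  set R : Fin m → ℝ := fun r => ∑ i, Real.exp (x i) * ‖A r i‖ ^ 2 with hR
  have hR0 : ∀ r, 0 ≤ R r := fun r => sum_nonneg fun i _ => by positivity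
  set D₁ : Fin m → ℂ := fun r => (Real.sqrt (w r / R r) : ℂ) with hD₁
  set D₂ : Fin n → ℂ := fun j => (Real.sqrt (Real.exp (x j)) : ℂ) with hD₂
  set B := Matrix.diagonal D₁ * A * Matrix.diagonal D₂ with hBdef
  have hBapp : ∀ r j, B r j = D₁ r * A r j * D₂ j := by
    intro r j; rw [hBdef, Matrix.mul_diagonal, Matrix.diagonal_mul]
  have hBn : ∀ r j, ‖B r j‖ ^ 2 = w r * (Real.exp (x j) * ‖A r j‖ ^ 2 / R r) := by
    intro r j
    rw [hBapp, norm_mul, norm_mul, mul_pow, mul_pow, hD₁, hD₂, Complex.norm_real,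
      Complex.norm_real, Real.norm_eq_abs, Real.norm_eq_abs, sq_abs, sq_abs,
      Real.sq_sqrt (div_nonneg (hw0 r) (hR0 r)), Real.sq_sqrt (Real.exp_pos _).le]
    ring
  have hBrow : ∀ r, ∑ j, ‖B r j‖ ^ 2 = w r := by
    intro r
    simp only [hBn]
    rw [← mul_sum, ← sum_div]
    by_cases h : R r = 0
    · have hAz : ∀ i, A r i = 0 := by
        intro i
        have := (sum_eq_zero_iff_of_nonneg (fun i _ => by positivity)).1 h i (mem_univ i)
        simpa [(Real.exp_pos _).ne'] using this
      have : w r = 0 := sum_eq_zero fun i _ => by simp [hp, hAz i]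
      simp [this]
    · rw [div_self h, mul_one]
  have hBcol : ∀ j, ∑ r, ‖B r j‖ ^ 2 ≤ k + δ := by
    intro j
    have := (abs_le.1 (hx j)).2
    rw [hpcol] at this
    simp only [hBn]
    linarith
  have hwsum : ∑ r, w r = n * k := by
    simp only [hw]
    rw [sum_comm, sum_congr rfl fun j _ => hpcol j]
    simp
  -- The trace is exact, with no `δ`, because the scaling matches row sums exactly.
  have htr : (B.conjTranspose * B).trace = ((n * k : ℝ) : ℂ) := by
    rw [← hwsum, ← sum_congr rfl fun r _ => hBrow r, Matrix.trace_mul_comm]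
    simp only [Matrix.trace, Matrix.diag_apply, Matrix.mul_apply, Matrix.conjTranspose_apply]
    push_cast
    exact sum_congr rfl fun r _ => sum_congr rfl fun j _ => Complex.mul_conj' _
  have hrank : (B.conjTranspose * B).rank ≤ A.rank :=
    (Matrix.rank_mul_le_right _ _).trans
      ((Matrix.rank_mul_le_left _ _).trans (Matrix.rank_mul_le_right _ _))
  have hmain := (Matrix.isHermitian_conjTranspose_mul_self B).sq_trace_le_rank_mul
  rw [htr, Complex.norm_real, Real.norm_eq_abs, sq_abs] at hmain
  refine hmain.trans ?_
  refine mul_le_mul (by exact_mod_cast hrank) ?_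
    (sum_nonneg fun _ _ => sum_nonneg fun _ _ => sq_nonneg _) (Nat.cast_nonneg _)
  refine (hA.sum_sq_norm_gram_le hq B (fun r j h => by simp [hBapp, h])
    fun r => (hBrow r).trans_le (hwq r)).trans ?_
  gcongr
  calc ∑ j, (∑ r, ‖B r j‖ ^ 2) ^ 2 ≤ ∑ j : Fin n, (k + δ) ^ 2 := by
        gcongr with j
        exact hBcol j
    _ = n * (k + δ) ^ 2 := by simp

theorem mainTheorem2 (m n q k t : ℕ) (hn : 1 ≤ n) (hk : 1 ≤ k)
    (A : Matrix (Fin m) (Fin n) ℂ) (hA : IsDesignMatrix A q k t) :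
    (A.rank : ℝ) ≥ (n : ℝ) / (1 + (q : ℝ) * ((q : ℝ) - 1) * m * t / ((n : ℝ) * (k : ℝ) ^ 2)) ∧
    (n : ℝ) / (1 + (q : ℝ) * ((q : ℝ) - 1) * m * t / ((n : ℝ) * (k : ℝ) ^ 2)) ≥
      (n : ℝ) - (m : ℝ) * t * q * ((q : ℝ) - 1) / (k : ℝ) ^ 2 := by
  -- If `q = 0` then `A = 0`, but a column has at least `k ≥ 1` nonzero entries.
  have hq : 1 ≤ q := by
    by_contra hq
    have hrow : ∀ i j, A i j = 0 := by
      intro i j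
      have h := hA.row_support i
      rw [show q = 0 by omega, Nat.le_zero, Set.ncard_eq_zero (Set.toFinite _),
        Function.support_eq_empty_iff] at h
      exact congrFun h j
    have h := hA.col_support ⟨0, hn⟩
    have h0 : Function.support (A.col ⟨0, hn⟩) = ∅ :=
      Function.support_eq_empty_iff.2 (funext fun i => hrow i _)
    rw [h0, Set.ncard_empty] at h
    omega
  have hn' : (0 : ℝ) < n := by exact_mod_cast hn
  have hk' : (0 : ℝ) < k := by exact_mod_cast hk
  have hq' : (0 : ℝ) ≤ q - 1 := by
    have : (1 : ℝ) ≤ q := by exact_mod_cast hq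
    linarith
  set E : ℝ := m * t * q * (q - 1) with hE
  have hE0 : 0 ≤ E := by positivity
  have hrank : ((n : ℝ) * k) ^ 2 ≤ A.rank * (n * (k : ℝ) ^ 2 + E) := by
    have hlim : Tendsto (fun δ : ℝ => (A.rank : ℝ) * (n * (k + δ) ^ 2 + E)) (𝓝[>] 0)
        (𝓝 (A.rank * (n * (k + 0) ^ 2 + E))) :=
      Continuous.tendsto' (by fun_prop) _ _ rfl |>.mono_left nhdsWithin_le_nhds
    rw [add_zero] at hlim
    exact ge_of_tendsto hlim (eventually_mem_nhdsWithin.mono fun δ hδ =>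
      hA.sq_le_rank_mul_add hq hk hδ)
  have hform : (n : ℝ) / (1 + (q : ℝ) * ((q : ℝ) - 1) * m * t / ((n : ℝ) * (k : ℝ) ^ 2)) =
      ((n : ℝ) * k) ^ 2 / (n * (k : ℝ) ^ 2 + E) := by
    rw [show (q : ℝ) * ((q : ℝ) - 1) * m * t = E by rw [hE]; ring]
    have : (n : ℝ) * (k : ℝ) ^ 2 + E ≠ 0 := by positivity
    field_simp
  have hpos : 0 < (n : ℝ) * (k : ℝ) ^ 2 + E := by positivity
  rw [hform]
  refine ⟨(div_le_iff₀ hpos).2 hrank, (le_div_iff₀ hpos).2 ?_⟩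
  -- The second inequality is a difference of squares.
  have : ((n : ℝ) - E / (k : ℝ) ^ 2) * (n * (k : ℝ) ^ 2 + E) =
      ((n : ℝ) * k) ^ 2 - E ^ 2 / (k : ℝ) ^ 2 := by
    field_simp
    ring
  rw [this]
  have : 0 ≤ E ^ 2 / (k : ℝ) ^ 2 := by positivity
  linarith
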